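/- Let $d$ be an odd prime, $n\ge 0$ an integer, $\omega=e^{2\pi i/d}$, and let $\{|k\rangle\}_{k\in\mathbb Z_d}$ be the computational basis of $\mathbb C^d$. Put $X|k\rangle=|k+1\rangle$, $Z|k\rangle=\omega^k|k\rangle$, $w(p,q)=\omega^{-2^{-1}pq}Z^pX^q$ for $p,q\in\mathbb Z_d$ (with $2^{-1}$ the inverse of $2$ in $\mathbb Z_d$), and for $x=(\vec p,\vec q)\in V^n:=\mathbb Z_d^n\times\mathbb Z_d^n$ let $w(x)=w(p_1,q_1)\otimes\cdots\otimes w(p_n,q_n)$. Let $T(0)=d^{-n}\sum_{u\in V^n}w(u)$ and $T(x)=w(x)T(0)w(x)^\dagger$. For an $n$-qudit state $\rho$ (a positive semidefinite operator on $(\mathbb C^d)^{\otimes n}$ with $\operatorname{Tr}\rho=1$), let $S_{\max}(\rho)=\log\operatorname{Rank}(\rho)$, let $W_\rho(x)=d^{-n}\operatorname{Tr}(T(x)^\dagger\rho)$ for $x\in V^n$ be its discrete Wigner function, and let $\chi_W(\rho)=\#\{x\in V^n: W_\rho(x)\neq 0\}$ be its Wigner rank. Call $\rho$ a pure stabilizer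 state if $\rho=|\psi\rangle\langle\psi|$ for a unit vector $\psi$ such that there are $n$ pairwise commuting operators $g_i=\omega^{k_i}w(x_i)$ ($k_i\in\mathbb Z_d$, $x_i\in V^n$), with $x_1,\dots,x_n$ linearly independent over $\mathbb Z_d$, satisfying $g_i\psi=\psi$ for $i=1,\dots,n$. Theorem (Uncertainty principle for Wigner rank). For every $n$-qudit state $\rho$, $$S_{\max}(\rho)+\log\chi_W(\rho)\ \ge\ n\log d,$$ and equality holds if and only if $\rho$ is a pure stabilizer state. -/

import Mathlib

open scoped Matrix ComplexOrder

noncomputable section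

/-- The index set of the computational basis of the `n`-qudit space `(ℂ^d)^{⊗ n}`:
the basis vector `|k₁⟩ ⊗ ⋯ ⊗ |kₙ⟩` is indexed by `(k₁, …, kₙ) ∈ (ℤ/d)^n`. -/
abbrev QuditIndex (d n : ℕ) : Type := Fin n → ZMod d

/-- Operators on the `n`-qudit space, as matrices in the computational basis. -/
abbrev QuditOp (d n : ℕ) : Type := Matrix (QuditIndex d n) (QuditIndex d n) ℂ

/-- The phase space `V^n = (ℤ/d)^n × (ℤ/d)^n`, with points `(p, q)`. -/
abbrev PhaseSpace (d n : ℕ) : Type := (Fin n → ZMod d) × (Fin n → ZMod d)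

/-- A quantum state: a positive semidefinite operator of trace one. -/
def IsQuantumState {d n : ℕ} [NeZero d] (ρ : QuditOp d n) : Prop :=
  ρ.PosSemidef ∧ ρ.trace = 1

/-- The phase `ω_d ^ a = exp (2 π i a / d)` for `a ∈ ℤ/d`. -/
def omegaPow (d : ℕ) [NeZero d] (a : ZMod d) : ℂ := ZMod.stdAddChar a

/-- The one-qudit shift `X : |k⟩ ↦ |k + 1⟩`. -/
def pauliX (d : ℕ) : Matrix (ZMod d) (ZMod d) ℂ :=
  Matrix.of fun j k => if j = k + 1 then 1 else 0

/-- The one-qudit clock `Z : |k⟩ ↦ ω_d ^ k |k⟩`. -/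
def pauliZ (d : ℕ) [NeZero d] : Matrix (ZMod d) (ZMod d) ℂ :=
  Matrix.diagonal (omegaPow d)

/-- The one-qudit Pauli operator `w(p, q) = ω_d ^ (-2⁻¹ p q) Z ^ p X ^ q` (`d` odd), where `2⁻¹` is
the inverse of `2` in `ℤ/d`. -/
def localPauli (d : ℕ) [NeZero d] (p q : ZMod d) : Matrix (ZMod d) (ZMod d) ℂ :=
  omegaPow d (-((2 : ZMod d)⁻¹ * p * q)) • (pauliZ d ^ p.val * pauliX d ^ q.val)

/-- The tensor product `A₁ ⊗ ⋯ ⊗ Aₙ` of one-qudit operators. -/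
def tensorOp {d n : ℕ} (A : Fin n → Matrix (ZMod d) (ZMod d) ℂ) : QuditOp d n :=
  Matrix.of fun s t => ∏ i, A i (s i) (t i)

/-- The `n`-qudit Pauli operator `w(p, q) = w(p₁, q₁) ⊗ ⋯ ⊗ w(pₙ, qₙ)`. -/
def pauliOp {d n : ℕ} [NeZero d] (x : PhaseSpace d n) : QuditOp d n :=
  tensorOp fun i => localPauli d (x.1 i) (x.2 i)

/-- The phase space point operator at the origin, `T(0) = d^{-n} ∑_u w(u)`. -/
def phasePointZero (d n : ℕ) [NeZero d] : QuditOp d n :=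
  ((d : ℂ) ^ n)⁻¹ • ∑ u : PhaseSpace d n, pauliOp u

/-- The phase space point operator `T(x) = w(x) T(0) w(x)†`. -/
def phasePoint {d n : ℕ} [NeZero d] (x : PhaseSpace d n) : QuditOp d n :=
  pauliOp x * phasePointZero d n * (pauliOp x)ᴴ

/-- The discrete Wigner function `W_ρ(x) = ⟨T(x), ρ⟩ = d^{-n} Tr (T(x)† ρ)`. -/
def wignerFunction {d n : ℕ} [NeZero d] (ρ : QuditOp d n) (x : PhaseSpace d n) : ℂ :=
  ((d : ℂ) ^ n)⁻¹ * ((phasePoint x)ᴴ * ρ).trace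

/-- The Wigner rank `χ_W(ρ)`: the size of the support of the Wigner function. -/
def wignerRank {d n : ℕ} [NeZero d] (ρ : QuditOp d n) : ℕ :=
  (Function.support (wignerFunction ρ)).ncard

/-- The max-entropy `S_max(ρ) = log Rank(ρ)`. -/
def maxEntropy {d n : ℕ} [NeZero d] (ρ : QuditOp d n) : ℝ :=
  Real.log (ρ.rank : ℝ)

/-- `ψ` is fixed by each of `n` pairwise commuting, independent elements
`g_i = ω_d ^ (k_i) w(x_i)` of the Pauli group, i.e. it is stabilized by a commuting subgroup of
Pauli operators with `n` generators. Independence of the generators means that their phase space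
points `x_i` are linearly independent over `ℤ/d`. -/
def IsStabilizerVector {d n : ℕ} [NeZero d] (ψ : QuditIndex d n → ℂ) : Prop :=
  ∃ (x : Fin n → PhaseSpace d n) (k : Fin n → ZMod d),
    LinearIndependent (ZMod d) x ∧
    (∀ i j, Commute (omegaPow d (k i) • pauliOp (x i)) (omegaPow d (k j) • pauliOp (x j))) ∧
    ∀ i, (omegaPow d (k i) • pauliOp (x i)) *ᵥ ψ = ψ

/-- `ρ` is a pure stabilizer state: `ρ = |ψ⟩⟨ψ|` for a unit stabilizer vector `ψ`. -/
def IsPureStabilizerState {d n : ℕ} [NeZero d] (ρ : QuditOp d n) : Prop :=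
  ∃ ψ : QuditIndex d n → ℂ,
    star ψ ⬝ᵥ ψ = 1 ∧ IsStabilizerVector ψ ∧ ρ = Matrix.vecMulVec ψ (star ψ)

end

/-!
The phase space point operators are reflections: `T(0)` is the parity `|t⟩ ↦ |-t⟩`, so that
`T(x) = w(2x) T(0)` is Hermitian with square `1` (`phasePoint_eq`, `phasePoint_mul_self`), and
`∑ x, T(x) = d ^ n` (`sum_phasePoint`). Hence the values of the Wigner function of a state are at
most `d ^ (-n)` and add up to `1`, so that at least `d ^ n` of them are nonzero
(`pow_le_wignerRank`). As the rank is at least `1`, the inequality follows, and equality holds if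
and only if the rank is `1` and the Wigner rank is `d ^ n`.

Suppose that both are minimal. Then `ρ = |ψ⟩⟨ψ|` (`exists_eq_vecMulVec_of_rank_eq_one`), and the
Wigner function equals `d ^ (-n)` on its support, which means that `T(x) ψ = ψ` there
(`phasePoint_mulVec_eq`). For two such points the product `T(x) T(y)`, a power of `ω` times
`w(2(x - y))`, fixes `ψ` as well. The phase space points of the Pauli operators that fix `ψ` up to
a power of `ω` form a subspace, which therefore has at least `d ^ n` points and contains `n`
independent vectors; the corresponding operators commute because they have a common fixed vector
(`isStabilizerVector_of_wignerRank_eq`).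

Conversely, let `ω ^ k • w(g)` fix `ψ`. The relation between `T(x) w(g)` and `w(-g) T(x)` shows
that the Wigner function vanishes unless the symplectic product `[x, g]` equals `k`
(`symplecticForm_eq_of_wignerFunction_ne_zero`). For `n` independent points `g` this leaves an
affine subspace of `d ^ n` points (`ncard_symplecticForm_eq_le`), so the Wigner rank is minimal.
-/

/-! ### Characters of `(ℤ/d)^n` -/

section Characters

variable {d : ℕ} [NeZero d]

theorem omegaPow_zero : omegaPow d 0 = 1 :=
  AddChar.map_zero_eq_one _

theorem omegaPow_add (a b : ZMod d) : omegaPow d (a + b) = omegaPow d a * omegaPow d b :=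
  AddChar.map_add_eq_mul _ a b

theorem star_omegaPow (a : ZMod d) : star (omegaPow d a) = omegaPow d (-a) :=
  (AddChar.map_neg_eq_conj _ a).symm

theorem omegaPow_eq_one_iff (a : ZMod d) : omegaPow d a = 1 ↔ a = 0 := by
  rw [← omegaPow_zero (d := d)]
  exact ZMod.injective_stdAddChar.eq_iff

theorem omegaPow_neg_mul_self (a : ZMod d) : omegaPow d (-a) * omegaPow d a = 1 := by
  rw [← omegaPow_add, neg_add_cancel, omegaPow_zero]

theorem omegaPow_sum {ι : Type*} (s : Finset ι) (f : ι → ZMod d) :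
    omegaPow d (∑ i ∈ s, f i) = ∏ i ∈ s, omegaPow d (f i) :=
  map_prod (ZMod.stdAddChar (N := d)).toMonoidHom (fun i => Multiplicative.ofAdd (f i)) s

/-- Orthogonality of the characters of `(ℤ/d)^n`. -/
theorem sum_omegaPow_dotProduct {n : ℕ} (v : Fin n → ZMod d) :
    ∑ p : Fin n → ZMod d, omegaPow d (p ⬝ᵥ v) = if v = 0 then (d : ℂ) ^ n else 0 := by
  have h1 : ∀ b : ZMod d, ∑ a : ZMod d, omegaPow d (a * b) = if b = 0 then (d : ℂ) else 0 := by
    intro b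
    have := AddChar.sum_mulShift b (ZMod.isPrimitive_stdAddChar d)
    rw [ZMod.card] at this
    exact_mod_cast this
  have h2 : ∑ p : Fin n → ZMod d, omegaPow d (p ⬝ᵥ v)
      = ∏ i, ∑ a : ZMod d, omegaPow d (a * v i) := by
    rw [Finset.prod_univ_sum, Fintype.piFinset_univ]
    simp only [dotProduct, omegaPow_sum]
  rw [h2]
  simp only [h1]
  split_ifs with hv
  · simp [hv]
  · obtain ⟨i, hi⟩ := Function.ne_iff.mp hv
    exact Finset.prod_eq_zero (Finset.mem_univ i) (if_neg hi)

end Characters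

/-! ### Pauli operators -/

section Pauli

variable {d n : ℕ}

theorem pauliX_pow_apply [NeZero d] (m : ℕ) (j k : ZMod d) :
    (pauliX d ^ m) j k = if j = k + m then 1 else 0 := by
  induction m generalizing j k with
  | zero => simp [Matrix.one_apply]
  | succ m ih =>
    rw [pow_succ, Matrix.mul_apply]
    have hX : ∀ l, pauliX d l k = if l = k + 1 then 1 else 0 := fun _ => rfl
    simp only [hX, ih, mul_ite, mul_one, mul_zero, Finset.sum_ite_eq', Finset.mem_univ, if_true]
    push_cast
    rw [add_assoc, add_comm (1 : ZMod d)]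

theorem localPauli_apply [NeZero d] (p q j k : ZMod d) :
    localPauli d p q j k
      = if j = k + q then omegaPow d (p * j - (2 : ZMod d)⁻¹ * p * q) else 0 := by
  have hp : omegaPow d j ^ p.val = omegaPow d (p * j) := by
    rw [omegaPow, ← AddChar.map_nsmul_eq_pow, omegaPow, nsmul_eq_mul, ZMod.natCast_zmod_val]
  rw [localPauli, pauliZ, Matrix.diagonal_pow, Matrix.smul_apply, Matrix.diagonal_mul,
    pauliX_pow_apply, ZMod.natCast_zmod_val, Pi.pow_apply, hp]
  split_ifs
  · rw [mul_one, smul_eq_mul, ← omegaPow_add]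
    ring_nf
  · simp

/-- Entries of the Pauli operators: `w(p, q) |t⟩ = ω ^ (p · (t + q) - 2⁻¹ p · q) |t + q⟩`. -/
theorem pauliOp_apply [NeZero d] (x : PhaseSpace d n) (s t : QuditIndex d n) :
    pauliOp x s t
      = if s = t + x.2 then omegaPow d (x.1 ⬝ᵥ s - 2⁻¹ * (x.1 ⬝ᵥ x.2)) else 0 := by
  simp only [pauliOp, tensorOp, Matrix.of_apply, localPauli_apply]
  split_ifs with h
  · have hi : ∀ i, s i = t i + x.2 i := congrFun h
    simp only [if_pos (hi _)]
    rw [← omegaPow_sum]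
    simp only [dotProduct, Finset.mul_sum, Finset.sum_sub_distrib, mul_assoc]
  · obtain ⟨i, hi⟩ := Function.ne_iff.mp h
    exact Finset.prod_eq_zero (Finset.mem_univ i) (if_neg hi)

/-- The standard symplectic form on phase space, `[(p, q), (p', q')] = p · q' - p' · q`. -/
def symplecticForm (d n : ℕ) :
    PhaseSpace d n →ₗ[ZMod d] PhaseSpace d n →ₗ[ZMod d] ZMod d :=
  LinearMap.mk₂ (ZMod d) (fun x y => x.1 ⬝ᵥ y.2 - y.1 ⬝ᵥ x.2)
    (fun x x' y => by simp [add_dotProduct, dotProduct_add]; ring)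
    (fun c x y => by simp [mul_sub])
    (fun x y y' => by simp [add_dotProduct, dotProduct_add]; ring)
    (fun c x y => by simp [mul_sub])

theorem symplecticForm_apply (x y : PhaseSpace d n) :
    symplecticForm d n x y = x.1 ⬝ᵥ y.2 - y.1 ⬝ᵥ x.2 := rfl

/-- The symplectic form is nondegenerate. -/
theorem eq_zero_of_symplecticForm_eq_zero {y : PhaseSpace d n}
    (h : ∀ x, symplecticForm d n x y = 0) : y = 0 := by
  refine Prod.ext (funext fun i => ?_) (funext fun i => ?_)
  · simpa [symplecticForm_apply] using h (0, Pi.single i 1)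
  · simpa [symplecticForm_apply] using h (Pi.single i 1, 0)

variable [Fact d.Prime]

/-- The Weyl relations. They need `d` odd, so that `2⁻¹ + 2⁻¹ = 1` in `ℤ/d`. -/
theorem pauliOp_mul (hd : (2 : ZMod d) ≠ 0) (x y : PhaseSpace d n) :
    pauliOp x * pauliOp y = omegaPow d (2⁻¹ * symplecticForm d n x y) • pauliOp (x + y) := by
  ext s t
  simp only [Matrix.mul_apply, Matrix.smul_apply, pauliOp_apply, mul_ite, mul_zero,
    Finset.sum_ite_eq', Finset.mem_univ, if_true, smul_eq_mul, Prod.snd_add, Prod.fst_add]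
  have e : s = t + y.2 + x.2 ↔ s = t + (x.2 + y.2) := by rw [add_assoc, add_comm y.2]
  by_cases h : s = t + y.2 + x.2
  · rw [if_pos h, if_pos (e.1 h), ← omegaPow_add, ← omegaPow_add, symplecticForm_apply]
    have ht : t + y.2 = s - x.2 := by rw [h, add_sub_cancel_right]
    rw [ht]
    congr 1
    simp only [add_dotProduct, dotProduct_add, dotProduct_sub]
    linear_combination (y.1 ⬝ᵥ x.2) * (mul_inv_cancel₀ hd)
  · rw [if_neg h, if_neg (mt e.2 h), zero_mul]

theorem pauliOp_zero : pauliOp (0 : PhaseSpace d n) = 1 := by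
  ext s t
  simp [pauliOp_apply, Matrix.one_apply, omegaPow_zero]

theorem conjTranspose_pauliOp (hd : (2 : ZMod d) ≠ 0) (x : PhaseSpace d n) :
    (pauliOp x)ᴴ = pauliOp (-x) := by
  ext s t
  rw [Matrix.conjTranspose_apply, pauliOp_apply, pauliOp_apply]
  have e : t = s + x.2 ↔ s = t + (-x).2 := by
    rw [Prod.snd_neg, ← sub_eq_add_neg, eq_sub_iff_add_eq, eq_comm]
  by_cases h : t = s + x.2
  · rw [if_pos h, if_pos (e.1 h), star_omegaPow]
    congr 1
    simp only [Prod.fst_neg, Prod.snd_neg, neg_dotProduct, dotProduct_neg, h, dotProduct_add]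
    linear_combination (x.1 ⬝ᵥ x.2) * (mul_inv_cancel₀ hd)
  · rw [if_neg h, if_neg (mt e.2 h), star_zero]

/-- Two Pauli operators commute up to a power of `ω` given by the symplectic form. -/
theorem pauliOp_mul_comm (hd : (2 : ZMod d) ≠ 0) (x y : PhaseSpace d n) :
    pauliOp x * pauliOp y = omegaPow d (symplecticForm d n x y) • (pauliOp y * pauliOp x) := by
  rw [pauliOp_mul hd, pauliOp_mul hd, smul_smul, ← omegaPow_add, add_comm y x]
  congr 2
  simp only [symplecticForm_apply]
  linear_combination (x.1 ⬝ᵥ y.2 - y.1 ⬝ᵥ x.2) * (mul_inv_cancel₀ hd)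

end Pauli

/-! ### Phase space point operators -/

section PhasePoint

variable {d n : ℕ} [Fact d.Prime]

/-- `T(0)` is the parity operator `|t⟩ ↦ |-t⟩`. -/
theorem phasePointZero_apply (hd : (2 : ZMod d) ≠ 0) (s t : QuditIndex d n) :
    phasePointZero d n s t = if s = -t then 1 else 0 := by
  have hdn : ((d : ℂ) ^ n) ≠ 0 := pow_ne_zero _ (Nat.cast_ne_zero.mpr (NeZero.ne d))
  have hu : ∀ p q : Fin n → ZMod d, pauliOp (p, q) s t
      = if q = s - t then omegaPow d (p ⬝ᵥ ((2⁻¹ : ZMod d) • (s + t))) else 0 := by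
    intro p q
    rw [pauliOp_apply]
    by_cases h : q = s - t
    · subst h
      rw [if_pos (by simp), if_pos rfl]
      congr 1
      simp only [dotProduct_sub, dotProduct_add, dotProduct_smul, smul_eq_mul]
      linear_combination (-(p ⬝ᵥ s)) * (mul_inv_cancel₀ hd)
    · rw [if_neg h, if_neg fun h' => h (by rw [h', add_sub_cancel_left])]
  rw [phasePointZero, Matrix.smul_apply, Matrix.sum_apply, Fintype.sum_prod_type]
  simp only [hu, Finset.sum_ite_eq', Finset.mem_univ, if_true]
  rw [sum_omegaPow_dotProduct]
  have e : (2⁻¹ : ZMod d) • (s + t) = 0 ↔ s = -t := by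
    rw [smul_eq_zero_iff_right (inv_ne_zero hd), add_eq_zero_iff_eq_neg]
  simp only [e, smul_eq_mul, mul_ite, mul_zero, inv_mul_cancel₀ hdn]

theorem phasePointZero_mul_self (hd : (2 : ZMod d) ≠ 0) :
    phasePointZero d n * phasePointZero d n = 1 := by
  ext s t
  simp [Matrix.mul_apply, phasePointZero_apply hd, Matrix.one_apply]

theorem phasePointZero_mul_pauliOp (hd : (2 : ZMod d) ≠ 0) (x : PhaseSpace d n) :
    phasePointZero d n * pauliOp x = pauliOp (-x) * phasePointZero d n := by
  ext s t
  have hs : ∀ u : QuditIndex d n, s = -u ↔ u = -s := fun u => by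
    rw [eq_comm, neg_eq_iff_eq_neg]
  have hL : (phasePointZero d n * pauliOp x) s t = pauliOp x (-s) t := by
    simp [Matrix.mul_apply, phasePointZero_apply hd, hs]
  have hR : (pauliOp (-x) * phasePointZero d n) s t = pauliOp (-x) s (-t) := by
    simp [Matrix.mul_apply, phasePointZero_apply hd]
  have e : -s = t + x.2 ↔ s = -t + (-x).2 := by
    rw [Prod.snd_neg, neg_eq_iff_eq_neg, neg_add]
  rw [hL, hR, pauliOp_apply, pauliOp_apply]
  simp only [e]
  simp

/-- A phase space point operator is a Pauli operator times the parity operator. -/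
theorem phasePoint_eq (hd : (2 : ZMod d) ≠ 0) (x : PhaseSpace d n) :
    phasePoint x = pauliOp (x + x) * phasePointZero d n := by
  rw [phasePoint, conjTranspose_pauliOp hd, mul_assoc, phasePointZero_mul_pauliOp hd, neg_neg,
    ← mul_assoc, pauliOp_mul hd]
  simp [symplecticForm_apply, omegaPow_zero]

theorem phasePoint_mul_phasePoint (hd : (2 : ZMod d) ≠ 0) (x y : PhaseSpace d n) :
    phasePoint x * phasePoint y = pauliOp (x + x) * pauliOp (-(y + y)) := by
  rw [phasePoint_eq hd, phasePoint_eq hd, ← mul_assoc, mul_assoc (pauliOp (x + x)),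
    phasePointZero_mul_pauliOp hd, mul_assoc, mul_assoc, phasePointZero_mul_self hd, mul_one]

theorem phasePoint_mul_self (hd : (2 : ZMod d) ≠ 0) (x : PhaseSpace d n) :
    phasePoint x * phasePoint x = 1 := by
  rw [phasePoint_mul_phasePoint hd, pauliOp_mul hd, add_neg_cancel, pauliOp_zero,
    map_neg]
  simp [symplecticForm_apply, omegaPow_zero]

theorem conjTranspose_phasePoint (hd : (2 : ZMod d) ≠ 0) (x : PhaseSpace d n) :
    (phasePoint x)ᴴ = phasePoint x := by
  have h0 : (phasePointZero d n)ᴴ = phasePointZero d n := by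
    ext s t
    rw [Matrix.conjTranspose_apply, phasePointZero_apply hd, phasePointZero_apply hd]
    have e : t = -s ↔ s = -t := by rw [eq_comm, neg_eq_iff_eq_neg]
    simp only [e]
    split_ifs <;> simp
  rw [phasePoint, Matrix.conjTranspose_mul, Matrix.conjTranspose_mul, h0,
    Matrix.conjTranspose_conjTranspose, mul_assoc]

theorem phasePoint_mul_pauliOp (hd : (2 : ZMod d) ≠ 0) (x g : PhaseSpace d n) :
    phasePoint x * pauliOp g
      = omegaPow d (-(2 * symplecticForm d n x g)) • (pauliOp (-g) * phasePoint x) := by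
  rw [phasePoint_eq hd, mul_assoc, phasePointZero_mul_pauliOp hd, ← mul_assoc,
    pauliOp_mul_comm hd, Matrix.smul_mul, mul_assoc]
  congr 2
  simp only [map_add, map_neg, LinearMap.add_apply]
  ring

/-- The phase space point operators resolve `d ^ n` times the identity, so that the values of
the Wigner function add up to the trace. -/
theorem sum_phasePoint (hd : (2 : ZMod d) ≠ 0) :
    ∑ x : PhaseSpace d n, phasePoint x = (d : ℂ) ^ n • (1 : QuditOp d n) := by
  have hx : ∀ (p q : Fin n → ZMod d) (s t : QuditIndex d n), phasePoint (p, q) s t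
      = if s = -t + (q + q) then omegaPow d (p ⬝ᵥ ((2 : ZMod d) • (s - q))) else 0 := by
    intro p q s t
    rw [phasePoint_eq hd, Matrix.mul_apply]
    simp only [phasePointZero_apply hd, mul_ite, mul_one, mul_zero, Finset.sum_ite_eq',
      Finset.mem_univ, if_true, pauliOp_apply, Prod.snd_add, Prod.fst_add]
    congr 2
    simp only [add_dotProduct, dotProduct_add, dotProduct_smul, dotProduct_sub, smul_eq_mul]
    linear_combination (-2 * (p ⬝ᵥ q)) * (mul_inv_cancel₀ hd)
  ext s t
  rw [Matrix.sum_apply, Fintype.sum_prod_type_right, Matrix.smul_apply, Matrix.one_apply]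
  have hq : ∀ q : Fin n → ZMod d, ∑ p : Fin n → ZMod d, phasePoint (p, q) s t
      = if q = s then (if s = t then (d : ℂ) ^ n else 0) else 0 := by
    intro q
    simp only [hx]
    have e1 : (2 : ZMod d) • (s - q) = 0 ↔ q = s := by
      rw [smul_eq_zero_iff_right hd, sub_eq_zero, eq_comm]
    split_ifs with h h1 h2 h1 h2
    · subst h1
      rw [sum_omegaPow_dotProduct, if_pos (e1.2 rfl)]
    · subst h1
      rw [neg_add_eq_sub, eq_sub_iff_add_eq, add_right_inj] at h
      exact absurd h.symm h2
    · rw [sum_omegaPow_dotProduct, if_neg (mt e1.1 h1)]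
    · subst h1 h2
      simp at h
    · simp
    · simp
  simp [hq]

end PhasePoint

/-! ### Bounds on the Wigner function -/

section Wigner

variable {d n : ℕ} [Fact d.Prime]

theorem sum_wignerFunction (hd : (2 : ZMod d) ≠ 0) (ρ : QuditOp d n) :
    ∑ x, wignerFunction ρ x = ρ.trace := by
  have hdn : ((d : ℂ) ^ n) ≠ 0 := pow_ne_zero _ (Nat.cast_ne_zero.mpr (NeZero.ne d))
  simp only [wignerFunction, conjTranspose_phasePoint hd]
  rw [← Finset.mul_sum, ← Matrix.trace_sum, ← Finset.sum_mul, sum_phasePoint hd, Matrix.smul_mul,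
    one_mul, Matrix.trace_smul, smul_eq_mul, inv_mul_cancel_left₀ hdn]

/-- `1 - T(x)` is, up to the factor `2`, a projection. -/
theorem one_sub_phasePoint_mul_self (hd : (2 : ZMod d) ≠ 0) (x : PhaseSpace d n) :
    (1 - phasePoint x)ᴴ * (1 - phasePoint x) = (2 : ℂ) • (1 - phasePoint x) := by
  rw [Matrix.conjTranspose_sub, Matrix.conjTranspose_one, conjTranspose_phasePoint hd, sub_mul,
    mul_sub, mul_sub, phasePoint_mul_self hd, two_smul]
  simp only [one_mul, mul_one]
  abel

theorem trace_phasePoint_mul_le (hd : (2 : ZMod d) ≠ 0) (x : PhaseSpace d n) {ρ : QuditOp d n}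
    (hρ : ρ.PosSemidef) : (phasePoint x * ρ).trace ≤ ρ.trace := by
  have h := (hρ.mul_mul_conjTranspose_same (1 - phasePoint x)).trace_nonneg
  rw [Matrix.trace_mul_comm, ← mul_assoc, one_sub_phasePoint_mul_self hd, Matrix.smul_mul,
    Matrix.trace_smul, smul_eq_mul, sub_mul, one_mul, Matrix.trace_sub] at h
  have h' := mul_nonneg (inv_nonneg.2 (zero_le_two (α := ℂ))) h
  rw [inv_mul_cancel_left₀ two_ne_zero] at h'
  exact sub_nonneg.mp h'

theorem wignerFunction_le (hd : (2 : ZMod d) ≠ 0) {ρ : QuditOp d n} (hρ : IsQuantumState ρ)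
    (x : PhaseSpace d n) : wignerFunction ρ x ≤ ((d : ℂ) ^ n)⁻¹ := by
  have h := trace_phasePoint_mul_le hd x hρ.1
  rw [hρ.2] at h
  rw [wignerFunction, conjTranspose_phasePoint hd]
  exact mul_le_of_le_one_right (by positivity) h

theorem pow_le_wignerRank (hd : (2 : ZMod d) ≠ 0) {ρ : QuditOp d n} (hρ : IsQuantumState ρ) :
    d ^ n ≤ wignerRank ρ := by
  classical
  have hdn : (0 : ℂ) < (d : ℂ) ^ n := by
    have : 0 < d := (Fact.out : d.Prime).pos
    positivity
  have h1 : ∑ x ∈ (Function.support (wignerFunction ρ)).toFinset, wignerFunction ρ x = 1 := by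
    rw [← hρ.2, ← sum_wignerFunction hd]
    exact Finset.sum_subset (Finset.subset_univ _) (by simp)
  have h2 := Finset.sum_le_card_nsmul _ _ _
    fun x (_ : x ∈ (Function.support (wignerFunction ρ)).toFinset) => wignerFunction_le hd hρ x
  rw [h1, ← Set.ncard_eq_toFinset_card', nsmul_eq_mul, ← div_eq_mul_inv, one_le_div₀ hdn] at h2
  exact_mod_cast h2

/-- If the Wigner rank is minimal, the Wigner function is maximal on its support. -/
theorem wignerFunction_eq_of_wignerRank_eq (hd : (2 : ZMod d) ≠ 0) {ρ : QuditOp d n}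
    (hρ : IsQuantumState ρ) (hr : wignerRank ρ = d ^ n) {x : PhaseSpace d n}
    (hx : wignerFunction ρ x ≠ 0) : wignerFunction ρ x = ((d : ℂ) ^ n)⁻¹ := by
  classical
  have hdn : ((d : ℂ) ^ n) ≠ 0 := pow_ne_zero _ (Nat.cast_ne_zero.mpr (NeZero.ne d))
  have h1 : ∑ x ∈ (Function.support (wignerFunction ρ)).toFinset, wignerFunction ρ x
      = ∑ x ∈ (Function.support (wignerFunction ρ)).toFinset, ((d : ℂ) ^ n)⁻¹ := by
    rw [Finset.sum_const, ← Set.ncard_eq_toFinset_card', nsmul_eq_mul,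
      show (Function.support (wignerFunction ρ)).ncard = d ^ n from hr, Nat.cast_pow,
      mul_inv_cancel₀ hdn, ← hρ.2, ← sum_wignerFunction hd]
    exact Finset.sum_subset (Finset.subset_univ _) (by simp)
  exact (Finset.sum_eq_sum_iff_of_le fun x _ => wignerFunction_le hd hρ x).1 h1 x
    (by simpa using hx)

theorem wignerFunction_vecMulVec (hd : (2 : ZMod d) ≠ 0) (ψ : QuditIndex d n → ℂ)
    (x : PhaseSpace d n) :
    wignerFunction (Matrix.vecMulVec ψ (star ψ)) x
      = ((d : ℂ) ^ n)⁻¹ * ((phasePoint x *ᵥ ψ) ⬝ᵥ star ψ) := by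
  rw [wignerFunction, conjTranspose_phasePoint hd, Matrix.mul_vecMulVec, Matrix.trace_vecMulVec]

/-- Equality in `wignerFunction_le` for a pure state means that `ψ` is fixed by `T(x)`. -/
theorem phasePoint_mulVec_eq (hd : (2 : ZMod d) ≠ 0) {ψ : QuditIndex d n → ℂ}
    (hψ : star ψ ⬝ᵥ ψ = 1) {x : PhaseSpace d n}
    (hx : wignerFunction (Matrix.vecMulVec ψ (star ψ)) x = ((d : ℂ) ^ n)⁻¹) :
    phasePoint x *ᵥ ψ = ψ := by
  have hdn : ((d : ℂ) ^ n) ≠ 0 := pow_ne_zero _ (Nat.cast_ne_zero.mpr (NeZero.ne d))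
  rw [wignerFunction_vecMulVec hd, mul_eq_left₀ (inv_ne_zero hdn)] at hx
  have h : star ((1 - phasePoint x) *ᵥ ψ) ⬝ᵥ ((1 - phasePoint x) *ᵥ ψ) = 0 := by
    rw [Matrix.star_mulVec, ← Matrix.dotProduct_mulVec, Matrix.mulVec_mulVec,
      one_sub_phasePoint_mul_self hd, Matrix.smul_mulVec, dotProduct_smul, Matrix.sub_mulVec,
      Matrix.one_mulVec, dotProduct_sub, hψ, dotProduct_comm, hx, sub_self, smul_zero]
  rw [dotProduct_star_self_eq_zero, Matrix.sub_mulVec, Matrix.one_mulVec, sub_eq_zero] at h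
  exact h.symm

end Wigner

/-! ### States of rank one -/

/-- A state of rank one is pure. -/
theorem exists_eq_vecMulVec_of_rank_eq_one {m : Type*} [Fintype m] [DecidableEq m]
    {ρ : Matrix m m ℂ} (hρ : ρ.PosSemidef) (ht : ρ.trace = 1) (hr : ρ.rank = 1) :
    ∃ ψ : m → ℂ, star ψ ⬝ᵥ ψ = 1 ∧ ρ = Matrix.vecMulVec ψ (star ψ) := by
  obtain ⟨⟨v, hv⟩, -, hspan⟩ := finrank_eq_one_iff'.1 hr
  -- The columns of `ρ` are the multiples `c j • v` of a vector `v` spanning its range.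
  have hc : ∀ j, ∃ c : ℂ, c • v = ρ *ᵥ Pi.single j 1 := fun j => by
    obtain ⟨c, hc⟩ := hspan ⟨ρ *ᵥ Pi.single j 1, ⟨Pi.single j 1, rfl⟩⟩
    exact ⟨c, congrArg Subtype.val hc⟩
  choose c hc using hc
  have hρc : ρ = Matrix.vecMulVec v c := by
    ext i j
    have := congrFun (hc j) i
    rw [Matrix.mulVec_single_one] at this
    rw [Matrix.vecMulVec_apply, mul_comm]
    exact this.symm
  have hcv : c ⬝ᵥ v = 1 := by
    rw [← ht, hρc, Matrix.trace_vecMulVec, dotProduct_comm]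
  -- Hence `ρ` is idempotent, and `ρ = ρ ρᴴ = ‖c‖² • v vᴴ`.
  have hs : ρ = (c ⬝ᵥ star c) • Matrix.vecMulVec v (star v) := by
    calc ρ = ρ * ρᴴ := by
          rw [hρ.1.eq]
          conv_rhs => rw [hρc, Matrix.vecMulVec_mul_vecMulVec, hcv, one_smul]
          exact hρc
      _ = _ := by
          rw [hρc, Matrix.conjTranspose_vecMulVec, Matrix.vecMulVec_mul_vecMulVec,
            Matrix.vecMulVec_smul]
  have h0 : 0 ≤ c ⬝ᵥ star c := by
    rw [dotProduct_comm]
    exact dotProduct_star_self_nonneg c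
  obtain ⟨r, hr0, hr⟩ : ∃ r : ℝ, 0 ≤ r ∧ (r : ℂ) = c ⬝ᵥ star c :=
    ⟨(c ⬝ᵥ star c).re, (Complex.nonneg_iff.1 h0).1, by
      rw [Complex.ext_iff]; exact ⟨rfl, (Complex.nonneg_iff.1 h0).2⟩⟩
  have hψ : ρ = Matrix.vecMulVec ((√r : ℂ) • v) (star ((√r : ℂ) • v)) := by
    rw [star_smul, Matrix.smul_vecMulVec, Matrix.vecMulVec_smul, smul_smul, Complex.star_def,
      Complex.conj_ofReal, ← Complex.ofReal_mul, Real.mul_self_sqrt hr0, hr]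
    exact hs
  refine ⟨(√r : ℂ) • v, ?_, hψ⟩
  rw [dotProduct_comm, ← Matrix.trace_vecMulVec, ← hψ, ht]

/-! ### The stabilizer of a vector -/

section Stabilizer

variable {d n : ℕ} [Fact d.Prime]

/-- The phase space points `v` for which some `ω ^ a • w(v)` fixes `ψ`. -/
def pauliStabilizer (hd : (2 : ZMod d) ≠ 0) (ψ : QuditIndex d n → ℂ) :
    AddSubgroup (PhaseSpace d n) where
  carrier := {v | ∃ a : ZMod d, (omegaPow d a • pauliOp v) *ᵥ ψ = ψ}
  zero_mem' := ⟨0, by rw [omegaPow_zero, one_smul, pauliOp_zero, Matrix.one_mulVec]⟩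
  add_mem' := by
    rintro u v ⟨a, ha⟩ ⟨b, hb⟩
    refine ⟨a + b + 2⁻¹ * symplecticForm d n u v, ?_⟩
    rw [omegaPow_add, ← smul_smul, ← pauliOp_mul hd, omegaPow_add, ← smul_mul_smul_comm,
      ← Matrix.mulVec_mulVec, hb, ha]
  neg_mem' := by
    rintro v ⟨a, ha⟩
    refine ⟨-a, ?_⟩
    have hv : pauliOp (-v) * pauliOp v = 1 := by
      rw [pauliOp_mul hd, neg_add_cancel, pauliOp_zero]
      simp [symplecticForm_apply, omegaPow_zero]
    conv_lhs => rw [← ha]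
    rw [Matrix.mulVec_mulVec, smul_mul_smul_comm, omegaPow_neg_mul_self, hv, one_smul,
      Matrix.one_mulVec]

theorem mem_pauliStabilizer {hd : (2 : ZMod d) ≠ 0} {ψ : QuditIndex d n → ℂ}
    {v : PhaseSpace d n} :
    v ∈ pauliStabilizer hd ψ ↔ ∃ a : ZMod d, (omegaPow d a • pauliOp v) *ᵥ ψ = ψ :=
  Iff.rfl

/-- If `T(x)` and `T(y)` both fix `ψ`, then so does their product, which is a Pauli operator. -/
theorem sub_add_sub_mem_pauliStabilizer (hd : (2 : ZMod d) ≠ 0) {ψ : QuditIndex d n → ℂ}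
    {x y : PhaseSpace d n} (hx : phasePoint x *ᵥ ψ = ψ) (hy : phasePoint y *ᵥ ψ = ψ) :
    (x - y) + (x - y) ∈ pauliStabilizer hd ψ := by
  have h : (phasePoint x * phasePoint y) *ᵥ ψ = ψ := by rw [← Matrix.mulVec_mulVec, hy, hx]
  rw [phasePoint_mul_phasePoint hd, pauliOp_mul hd] at h
  rw [show (x - y) + (x - y) = x + x + -(y + y) by abel]
  exact ⟨_, h⟩

/-- Pauli operators with a common fixed vector commute: they do so up to a scalar, and comparing
both sides on the fixed vector shows that the scalar is `1`. -/
theorem commute_of_mulVec_eq (hd : (2 : ZMod d) ≠ 0) {ψ : QuditIndex d n → ℂ} (hψ : ψ ≠ 0)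
    {u v : PhaseSpace d n} {a b : ZMod d} (hu : (omegaPow d a • pauliOp u) *ᵥ ψ = ψ)
    (hv : (omegaPow d b • pauliOp v) *ᵥ ψ = ψ) :
    Commute (omegaPow d a • pauliOp u) (omegaPow d b • pauliOp v) := by
  have h : (omegaPow d a • pauliOp u) * (omegaPow d b • pauliOp v)
      = omegaPow d (symplecticForm d n u v)
        • ((omegaPow d b • pauliOp v) * (omegaPow d a • pauliOp u)) := by
    rw [smul_mul_smul_comm, smul_mul_smul_comm, pauliOp_mul_comm hd, smul_comm,
      mul_comm (omegaPow d a)]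
  have h1 := congrArg (· *ᵥ ψ) h
  simp only [Matrix.smul_mulVec _ (_ * _), ← Matrix.mulVec_mulVec, hu, hv] at h1
  have h2 : omegaPow d (symplecticForm d n u v) = 1 := by
    obtain ⟨s, hs⟩ := Function.ne_iff.mp hψ
    have := congrFun h1 s
    rw [Pi.smul_apply, smul_eq_mul] at this
    exact (mul_eq_right₀ hs).1 this.symm
  rw [h2, one_smul] at h
  exact h

theorem isStabilizerVector_of_pow_le_card (hd : (2 : ZMod d) ≠ 0) {ψ : QuditIndex d n → ℂ}
    (hψ : ψ ≠ 0) (hG : d ^ n ≤ Nat.card (pauliStabilizer hd ψ)) : IsStabilizerVector ψ := by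
  let G : Submodule (ZMod d) (PhaseSpace d n) :=
    AddSubgroup.toZModSubmodule d (pauliStabilizer hd ψ)
  have hn : n ≤ Module.finrank (ZMod d) G := by
    have h : Nat.card G = d ^ Module.finrank (ZMod d) G := by
      rw [Module.natCard_eq_pow_finrank (K := ZMod d), Nat.card_zmod]
    refine (Nat.pow_le_pow_iff_right (Fact.out : d.Prime).one_lt).1 ?_
    rw [← h]
    exact hG
  let x : Fin n → G := Module.finBasis (ZMod d) G ∘ Fin.castLE hn
  choose k hk using fun i => mem_pauliStabilizer (hd := hd).1 (x i).2
  refine ⟨fun i => x i, k, ?_, fun i j => commute_of_mulVec_eq hd hψ (hk i) (hk j), hk⟩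
  exact ((Module.finBasis (ZMod d) G).linearIndependent.comp _
    (Fin.castLE_injective hn)).map' G.subtype G.ker_subtype

/-- A pure state of minimal Wigner rank is a stabilizer state: the doubled differences of points
in the support of its Wigner function lie in the stabilizer, which is therefore large enough. -/
theorem isStabilizerVector_of_wignerRank_eq (hd : (2 : ZMod d) ≠ 0) {ψ : QuditIndex d n → ℂ}
    (hψ : star ψ ⬝ᵥ ψ = 1) (hρ : IsQuantumState (Matrix.vecMulVec ψ (star ψ)))
    (hr : wignerRank (Matrix.vecMulVec ψ (star ψ)) = d ^ n) : IsStabilizerVector ψ := by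
  have hψ0 : ψ ≠ 0 := by
    rintro rfl
    simp at hψ
  refine isStabilizerVector_of_pow_le_card hd hψ0 ?_
  have hfix : ∀ x ∈ Function.support (wignerFunction (Matrix.vecMulVec ψ (star ψ))),
      phasePoint x *ᵥ ψ = ψ := fun x hx =>
    phasePoint_mulVec_eq hd hψ (wignerFunction_eq_of_wignerRank_eq hd hρ hr hx)
  have hpos : 0 < d ^ n := pow_pos (Fact.out : d.Prime).pos n
  obtain ⟨y, hy⟩ : (Function.support (wignerFunction (Matrix.vecMulVec ψ (star ψ)))).Nonempty :=
    Set.nonempty_of_ncard_ne_zero (hr.trans_ne hpos.ne')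
  rw [← hr, wignerRank]
  refine Set.ncard_le_ncard_of_injOn (t := (pauliStabilizer hd ψ : Set (PhaseSpace d n)))
    (fun x => (x - y) + (x - y))
    (fun x hx => sub_add_sub_mem_pauliStabilizer hd (hfix x hx) (hfix y hy)) ?_ (Set.toFinite _)
  intro x _ x' _ h
  simp only [← two_smul (ZMod d)] at h
  exact sub_left_injective (smul_right_injective _ hd h)

/-- If `ω ^ k • w(g)` fixes `ψ`, the Wigner function of `ψ` is supported on the affine hyperplane
`[x, g] = k`. -/
theorem symplecticForm_eq_of_wignerFunction_ne_zero (hd : (2 : ZMod d) ≠ 0)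
    {ψ : QuditIndex d n → ℂ} {g x : PhaseSpace d n} {k : ZMod d}
    (hg : (omegaPow d k • pauliOp g) *ᵥ ψ = ψ)
    (hx : wignerFunction (Matrix.vecMulVec ψ (star ψ)) x ≠ 0) : symplecticForm d n x g = k := by
  rw [wignerFunction_vecMulVec hd] at hx
  have hz := right_ne_zero_of_mul hx
  set φ := phasePoint x *ᵥ ψ with hφ
  have h1 : φ = omegaPow d (k - 2 * symplecticForm d n x g) • (pauliOp (-g) *ᵥ φ) := by
    conv_lhs => rw [hφ, ← hg, Matrix.mulVec_mulVec, Matrix.mul_smul, phasePoint_mul_pauliOp hd,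
      smul_smul, ← omegaPow_add, ← sub_eq_add_neg, Matrix.smul_mulVec, ← Matrix.mulVec_mulVec]
  have h2 : (pauliOp (-g) *ᵥ φ) ⬝ᵥ star ψ = omegaPow d k * (φ ⬝ᵥ star ψ) := by
    have hs : star ψ = omegaPow d (-k) • (star ψ ᵥ* pauliOp (-g)) := by
      conv_lhs => rw [← hg, Matrix.smul_mulVec, star_smul, star_omegaPow, Matrix.star_mulVec,
        conjTranspose_pauliOp hd]
    conv_rhs => rw [hs, dotProduct_smul, smul_eq_mul, ← mul_assoc, ← omegaPow_add,
      add_neg_cancel, omegaPow_zero, one_mul, dotProduct_comm, ← Matrix.dotProduct_mulVec]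
    rw [dotProduct_comm]
  have h3 : φ ⬝ᵥ star ψ
      = omegaPow d (k - 2 * symplecticForm d n x g + k) * (φ ⬝ᵥ star ψ) := by
    rw [omegaPow_add, mul_assoc, ← h2]
    conv_lhs => rw [h1, smul_dotProduct, smul_eq_mul]
  have h4 := (omegaPow_eq_one_iff _).1 ((mul_eq_right₀ hz).1 h3.symm)
  refine mul_left_cancel₀ hd ?_
  linear_combination -h4

/-- The points of phase space whose symplectic products with `n` linearly independent vectors are
prescribed form an affine subspace of dimension `2n - n = n`. -/
theorem ncard_symplecticForm_eq_le {g : Fin n → PhaseSpace d n} (hg : LinearIndependent (ZMod d) g)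
    (k : Fin n → ZMod d) : {x | ∀ i, symplecticForm d n x (g i) = k i}.ncard ≤ d ^ n := by
  let L : PhaseSpace d n →ₗ[ZMod d] (Fin n → ZMod d) :=
    LinearMap.pi fun i => (symplecticForm d n).flip (g i)
  have hL : ∀ x i, L x i = symplecticForm d n x (g i) := fun _ _ => rfl
  have hsurj : LinearMap.range L = ⊤ := by
    by_contra hne
    obtain ⟨f, hf, hle⟩ := Submodule.exists_le_ker_of_lt_top _ (lt_top_iff_ne_top.2 hne)
    -- A functional `f` vanishing on the range of `L` is a linear relation between the `g i`.
    have h0 : ∑ i, f (Pi.single i 1) • g i = 0 := by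
      refine eq_zero_of_symplecticForm_eq_zero fun x => ?_
      have hfx : f (L x) = 0 := hle ⟨x, rfl⟩
      rw [LinearMap.pi_apply_eq_sum_univ f (L x)] at hfx
      rw [map_sum, ← hfx]
      refine Finset.sum_congr rfl fun i _ => ?_
      rw [map_smul, hL, smul_eq_mul, smul_eq_mul, mul_comm]
      congr 2
      ext j
      simp [Pi.single_apply, eq_comm]
    refine hf (LinearMap.pi_ext' fun i => LinearMap.ext_ring ?_)
    simpa using Fintype.linearIndependent_iff.1 hg _ h0 i
  have hker : Module.finrank (ZMod d) (LinearMap.ker L) = n := by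
    have h := L.finrank_range_add_finrank_ker
    rw [hsurj, finrank_top, Module.finrank_prod, Module.finrank_fin_fun] at h
    exact add_left_cancel h
  have hcard : Nat.card (LinearMap.ker L) = d ^ n := by
    rw [Module.natCard_eq_pow_finrank (K := ZMod d), Nat.card_zmod, hker]
  rcases Set.eq_empty_or_nonempty {x | ∀ i, symplecticForm d n x (g i) = k i} with he | ⟨y, hy⟩
  · simp [he]
  · rw [← hcard]
    refine Set.ncard_le_ncard_of_injOn (t := (LinearMap.ker L : Set (PhaseSpace d n)))
      (fun x => x - y) (fun x hx => ?_) (sub_left_injective.injOn) (Set.toFinite _)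
    rw [SetLike.mem_coe, LinearMap.mem_ker, map_sub, sub_eq_zero]
    ext i
    rw [hL, hL, hx i, hy i]

theorem wignerRank_le_of_isStabilizerVector (hd : (2 : ZMod d) ≠ 0) {ψ : QuditIndex d n → ℂ}
    (hψ : IsStabilizerVector ψ) : wignerRank (Matrix.vecMulVec ψ (star ψ)) ≤ d ^ n := by
  obtain ⟨g, k, hg, -, hfix⟩ := hψ
  refine le_trans (Set.ncard_le_ncard ?_ (Set.toFinite _)) (ncard_symplecticForm_eq_le hg k)
  exact fun x hx i => symplecticForm_eq_of_wignerFunction_ne_zero hd (hfix i) hx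

end Stabilizer

/-! ### The uncertainty principle -/

theorem mainTheorem3 (d n : ℕ) [Fact d.Prime] (hd : Odd d)
    (ρ : QuditOp d n) (hρ : IsQuantumState ρ) :
    (n : ℝ) * Real.log (d : ℝ) ≤ maxEntropy ρ + Real.log (wignerRank ρ : ℝ) ∧
      (maxEntropy ρ + Real.log (wignerRank ρ : ℝ) = (n : ℝ) * Real.log (d : ℝ) ↔
        IsPureStabilizerState ρ) := by
  have h2 : (2 : ZMod d) ≠ 0 := by
    intro h
    have h' : d ∣ 2 := (ZMod.natCast_eq_zero_iff 2 d).1 (by exact_mod_cast h)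
    rw [(Nat.prime_dvd_prime_iff_eq Fact.out Nat.prime_two).1 h'] at hd
    exact absurd hd (by decide)
  have hpos : 0 < d ^ n := pow_pos (Fact.out : d.Prime).pos n
  have hχ : d ^ n ≤ wignerRank ρ := pow_le_wignerRank h2 hρ
  have hrank : 1 ≤ ρ.rank := by
    rw [Nat.one_le_iff_ne_zero]
    intro h
    have h0 : ρ.mulVecLin = 0 := LinearMap.range_eq_bot.1 (Submodule.finrank_eq_zero.1 h)
    have h1 : ρ = 0 := Matrix.ext_of_mulVec_single fun i => by
      rw [Matrix.zero_mulVec]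
      exact LinearMap.congr_fun h0 _
    simpa [h1] using hρ.2
  have hlog : (n : ℝ) * Real.log d = Real.log ((d ^ n : ℕ) : ℝ) := by
    rw [Nat.cast_pow, Real.log_pow]
  have hS : 0 ≤ maxEntropy ρ := Real.log_natCast_nonneg _
  have hW : (n : ℝ) * Real.log d ≤ Real.log (wignerRank ρ : ℝ) := by
    rw [hlog]
    exact Real.log_le_log (by exact_mod_cast hpos) (by exact_mod_cast hχ)
  refine ⟨by linarith, fun heq => ?_, ?_⟩
  · have hr : ρ.rank = 1 := by
      have h0 : Real.log (ρ.rank : ℝ) = Real.log 1 := by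
        rw [Real.log_one]
        exact le_antisymm (by change maxEntropy ρ ≤ 0; linarith) hS
      exact_mod_cast Real.log_injOn_pos (Set.mem_Ioi.2 (by exact_mod_cast hrank))
        (Set.mem_Ioi.2 one_pos) h0
    have hw : wignerRank ρ = d ^ n := by
      have h0 : Real.log (wignerRank ρ : ℝ) = Real.log ((d ^ n : ℕ) : ℝ) := by
        rw [← hlog]
        linarith
      exact_mod_cast Real.log_injOn_pos (Set.mem_Ioi.2 (by exact_mod_cast hpos.trans_le hχ))
        (Set.mem_Ioi.2 (by exact_mod_cast hpos)) h0
    obtain ⟨ψ, hψ, rfl⟩ := exists_eq_vecMulVec_of_rank_eq_one hρ.1 hρ.2 hr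
    exact ⟨ψ, hψ, isStabilizerVector_of_wignerRank_eq h2 hψ hρ hw, rfl⟩
  · rintro ⟨ψ, -, hstab, rfl⟩
    have hw := le_antisymm (wignerRank_le_of_isStabilizerVector h2 hstab) hχ
    have hr := le_antisymm (Matrix.rank_vecMulVec_le ψ (star ψ)) hrank
    rw [maxEntropy, hr, hw, hlog, Nat.cast_one, Real.log_one, zero_add]
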